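/- Consider the following game. One starts with $n$ coins, each of which lands heads with probability $p$. In every round all remaining coins are tossed independently, and the player, after seeing the outcome, sets aside at least one of them (of any outcome); coins that are set aside are not tossed again. The game ends when all coins have been set aside. Let $v_{n,p}$ be the supremum, over all strategies, of the expected number of heads among the coins set aside, and put $s_n(p) = v_{n,p} - n + 1 - p$. Proposition. For every $p \in [\frac12, 1]$ the limit $s(p) = \lim_{n\to\infty} s_n(p)$ exists. There is a constant $p_0 \in (\frac12, 1)$ (necessarily unique) such that $s(p_0) = 0$, $s(p) < 0$ for $\frac12 \le p < p_0$, and $s(p) > 0$ for $p_0 < p < 1$. The function $s$ is differentiable at $p_0$ and $s'(p_0) > 0$. Moreover, every $s_n$ is differentiable at $p_0$, and $s'(p_0) = \lim_{n\to\infty} s_n'(p_0)$. -/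

import Mathlib

open Filter Topology

namespace CoinGame

/-- A (history-dependent) strategy for the game in which the coins of the finite set `R` remain.
If no coin remains, the game is over. Otherwise all coins of `R` are tossed; when `H` is the set
of coins that land heads, the player sets aside the non-empty set `aside H` of remaining coins and
goes on with a strategy for the coins that are left, which may depend on `H`. -/
inductive Strategy : Finset ℕ → Type
  | done : Strategy ∅
  | toss {R : Finset ℕ} (aside : Finset ℕ → Finset ℕ)
      (aside_subset : ∀ H, aside H ⊆ R)
      (aside_nonempty : ∀ H, (aside H).Nonempty)
      (next : ∀ H, Strategy (R \ aside H)) : Strategy R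

/-- The expected final number of heads among the coins that are set aside, when every toss of every
coin independently lands heads with probability `p`. The set of heads in a toss of the coins of `R`
is `H ⊆ R` with probability `p ^ |H| * (1 - p) ^ |R \ H|`; the coins of `aside H ∩ H` are set aside
showing heads. -/
noncomputable def Strategy.value (p : ℝ) : {R : Finset ℕ} → Strategy R → ℝ
  | _, .done => 0
  | R, .toss aside _ _ next =>
      ∑ H ∈ R.powerset, p ^ H.card * (1 - p) ^ (R \ H).card *
        (((aside H ∩ H).card : ℝ) + (next H).value p)

/-- `v n p`: the expected number of heads under optimal play with `n` coins. -/
noncomputable def v (n : ℕ) (p : ℝ) : ℝ :=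
  ⨆ σ : Strategy (Finset.range n), σ.value p

/-- `sSeq n p = v n p - n + 1 - p`. -/
noncomputable def sSeq (n : ℕ) (p : ℝ) : ℝ := v n p - n + 1 - p

/-- The limit of `sSeq n p` as `n → ∞`. -/
noncomputable def s (p : ℝ) : ℝ := limUnder atTop (fun n : ℕ => sSeq n p)

end CoinGame

/-! Write s_n for `sSeq n p`; s_0 = 1 - p and s_1 = 0. After k ≥ 1 heads among m + 1 coins, keeping
j ≥ m + 1 - k coins is worth s_j in normalized form; only a toss without heads costs an extra 1.
Hence, if s_2 ≤ ... ≤ s_m ≤ 1 - p, it is optimal to keep m coins, except that all heads end the game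
and, when s_m < 0, a single tail is kept alone. On [1/2, 5/8] this monotonicity propagates
(`sSeq_increases`), so `sSeq_succ_eq` is an exact recursion. It is linear while s_n ≤ 0; its linear
form is `linSeq`, with limit `linLim`.

For p > 1/2, once `linSeq` is nonnegative at a positive index its limit is positive (`linLim_pos`).
So where `linLim` ≤ 0, the game follows `linSeq` forever and s = `linLim`. There, differences and
derivatives in p obey the same contraction with nonnegative source terms: `linLim` increases
strictly up to its zero p₀ and has positive derivative at p₀.

To the right of p₀ the game may leave `linSeq`. Near p₀ this happens only at late indices, where the
coefficients have a small sum, and `linSeq` exceeds 0 by O(|p - p₀|) only. Hence s - `linLim` = o(|p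
- p₀|), and s inherits the derivative of `linLim`. For p ≥ 5/8 a cruder lower bound gives s > 0. -/

namespace CoinGame

/-! ### Optimal play and the Bellman recursion -/

/-- The optimal expected number of heads, by the Bellman recursion: with `k` heads among `m + 1`
coins, the player chooses the number `j` of coins that stay in the game. -/
noncomputable def bellman (p : ℝ) : ℕ → ℝ
  | 0 => 0
  | m + 1 => ∑ k ∈ Finset.range (m + 2), (m + 1).choose k * (p ^ k * (1 - p) ^ (m + 1 - k)) *
      ⨆ j : Fin (m + 1), ((min (m + 1 - j.1) k : ℕ) + bellman p j.1 : ℝ)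

/-- The best continuation value after `k` heads among `m + 1` coins. -/
noncomputable def bestReply (p : ℝ) (m k : ℕ) : ℝ :=
  ⨆ j : Fin (m + 1), ((min (m + 1 - j.1) k : ℕ) + bellman p j.1 : ℝ)

/-- The binomial weights. -/
noncomputable def binomWeight (p : ℝ) (n k : ℕ) : ℝ := n.choose k * (p ^ k * (1 - p) ^ (n - k))

theorem bellman_succ (p : ℝ) (m : ℕ) :
    bellman p (m + 1) = ∑ k ∈ Finset.range (m + 2), binomWeight p (m + 1) k * bestReply p m k := by
  rw [bellman]; rfl

theorem binomWeight_nonneg {p : ℝ} (h0 : 0 ≤ p) (h1 : p ≤ 1) (n k : ℕ) :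
    0 ≤ binomWeight p n k := by
  have : 0 ≤ 1 - p := by linarith
  unfold binomWeight; positivity

theorem sum_binomWeight (p : ℝ) (n : ℕ) :
    ∑ k ∈ Finset.range (n + 1), binomWeight p n k = 1 := by
  have h := add_pow p (1 - p) n
  rw [add_sub_cancel, one_pow] at h
  rw [h]
  exact Finset.sum_congr rfl fun k _ => by unfold binomWeight; ring

theorem le_bestReply (p : ℝ) {m j : ℕ} (k : ℕ) (hj : j ≤ m) :
    ((min (m + 1 - j) k : ℕ) + bellman p j : ℝ) ≤ bestReply p m k :=
  le_ciSup (f := fun j : Fin (m + 1) => ((min (m + 1 - j.1) k : ℕ) + bellman p j.1 : ℝ))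
    (Set.finite_range _).bddAbove ⟨j, by omega⟩

theorem bestReply_le {p x : ℝ} {m k : ℕ}
    (h : ∀ j ≤ m, ((min (m + 1 - j) k : ℕ) + bellman p j : ℝ) ≤ x) : bestReply p m k ≤ x :=
  ciSup_le fun j => h j.1 (by omega)

theorem exists_bestReply_eq (p : ℝ) (m k : ℕ) :
    ∃ j ≤ m, bestReply p m k = ((min (m + 1 - j) k : ℕ) + bellman p j : ℝ) := by
  obtain ⟨j, hj⟩ := exists_eq_ciSup_of_finite
    (f := fun j : Fin (m + 1) => ((min (m + 1 - j.1) k : ℕ) + bellman p j.1 : ℝ))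
  exact ⟨j.1, by omega, hj.symm⟩

theorem sum_powerset_eq_bellman (p : ℝ) {R : Finset ℕ} {m : ℕ} (hR : R.card = m + 1) :
    ∑ H ∈ R.powerset, p ^ H.card * (1 - p) ^ (R \ H).card * bestReply p m H.card =
      bellman p (m + 1) := by
  rw [bellman_succ, ← hR, Finset.sum_congr rfl (g := fun H : Finset ℕ =>
    p ^ H.card * (1 - p) ^ (R.card - H.card) * bestReply p m H.card),
    Finset.sum_powerset_apply_card (fun k => p ^ k * (1 - p) ^ (R.card - k) * bestReply p m k), hR]
  · refine Finset.sum_congr rfl fun k _ => ?_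
    unfold binomWeight
    rw [nsmul_eq_mul]; ring
  · intro H hH
    rw [Finset.card_sdiff_of_subset (Finset.mem_powerset.1 hH)]

theorem Strategy.value_le {p : ℝ} (h0 : 0 ≤ p) (h1 : p ≤ 1) {R : Finset ℕ} (σ : Strategy R) :
    σ.value p ≤ bellman p R.card := by
  have hq : 0 ≤ 1 - p := by linarith
  induction σ with
  | done => simp [Strategy.value, bellman]
  | @toss R aside hsub hne next ih =>
    have hpos : 0 < R.card := Finset.card_pos.2 ((hne ∅).mono (hsub ∅))
    obtain ⟨m, hm⟩ : ∃ m, R.card = m + 1 := ⟨R.card - 1, by omega⟩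
    rw [hm, ← sum_powerset_eq_bellman p hm, Strategy.value]
    refine Finset.sum_le_sum fun H _ => mul_le_mul_of_nonneg_left ?_ (by positivity)
    have hc := Finset.card_sdiff_of_subset (hsub H)
    have hA := Finset.card_pos.2 (hne H)
    have hAR := Finset.card_le_card (hsub H)
    refine le_trans ?_ (le_bestReply p (j := (R \ aside H).card) H.card (by omega))
    refine add_le_add ?_ (ih H)
    have : (aside H ∩ H).card ≤ min (m + 1 - (R \ aside H).card) H.card := by
      refine le_min ?_ (Finset.card_le_card Finset.inter_subset_right)
      have := Finset.card_le_card (Finset.inter_subset_left : aside H ∩ H ⊆ aside H)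
      omega
    exact_mod_cast this

theorem exists_subset_card_inter {R H : Finset ℕ} {a : ℕ} (hH : H ⊆ R) (ha : a ≤ R.card) :
    ∃ A ⊆ R, A.card = a ∧ (A ∩ H).card = min a H.card := by
  rcases le_total a H.card with h | h
  · obtain ⟨A, hA, hc⟩ := Finset.exists_subset_card_eq h
    exact ⟨A, hA.trans hH, hc, by rw [Finset.inter_eq_left.2 hA, hc, min_eq_left h]⟩
  · obtain ⟨A, hHA, hAR, hc⟩ := Finset.exists_subsuperset_card_eq hH h ha
    exact ⟨A, hAR, hc, by rw [Finset.inter_eq_right.2 hHA, min_eq_right h]⟩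

theorem Strategy.exists_value_eq (p : ℝ) (n : ℕ) (R : Finset ℕ) (hR : R.card = n) :
    ∃ σ : Strategy R, σ.value p = bellman p n := by
  induction n using Nat.strong_induction_on generalizing R with
  | _ n ih =>
    rcases n with _ | m
    · obtain rfl := Finset.card_eq_zero.1 hR
      exact ⟨.done, by simp [Strategy.value, bellman]⟩
    -- A strategy must answer every `H`, even one not contained in `R`; intersecting with `R` makes
    -- the choice legitimate there too.
    · have key : ∀ H : Finset ℕ, ∃ A ⊆ R, A.Nonempty ∧ ∃ σ : Strategy (R \ A),
          H ⊆ R → ((A ∩ H).card : ℝ) + σ.value p = bestReply p m H.card := by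
        intro H
        obtain ⟨j, hj, hbest⟩ := exists_bestReply_eq p m (H ∩ R).card
        obtain ⟨A, hA, hc, hi⟩ := exists_subset_card_inter (R := R) (H := H ∩ R)
          (a := m + 1 - j) Finset.inter_subset_right (by omega)
        obtain ⟨σ, hσ⟩ := ih j (by omega) (R \ A) (by
          rw [Finset.card_sdiff_of_subset hA]; omega)
        refine ⟨A, hA, Finset.card_pos.1 (by omega), σ, fun hH => ?_⟩
        rw [Finset.inter_eq_left.2 hH] at hi hbest
        rw [hi, hσ, hbest]
      choose A hA hne σ hσ using key
      refine ⟨.toss A hA hne σ, ?_⟩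
      rw [← sum_powerset_eq_bellman p hR, Strategy.value]
      exact Finset.sum_congr rfl fun H hH => by rw [hσ H (Finset.mem_powerset.1 hH)]

theorem v_eq_bellman {p : ℝ} (h0 : 0 ≤ p) (h1 : p ≤ 1) (n : ℕ) : v n p = bellman p n := by
  have hle : ∀ σ : Strategy (Finset.range n), σ.value p ≤ bellman p n := fun σ => by
    simpa using σ.value_le h0 h1
  obtain ⟨σ, hσ⟩ := Strategy.exists_value_eq p n (Finset.range n) (Finset.card_range n)
  have : Nonempty (Strategy (Finset.range n)) := ⟨σ⟩
  refine le_antisymm (ciSup_le hle) ?_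
  rw [← hσ]
  exact le_ciSup (f := fun τ : Strategy (Finset.range n) => τ.value p)
    ⟨bellman p n, by rintro _ ⟨τ, rfl⟩; exact hle τ⟩ σ

/-! ### The normalized sequence and its recursion -/

theorem sSeq_eq {p : ℝ} (h0 : 0 ≤ p) (h1 : p ≤ 1) (n : ℕ) :
    sSeq n p = bellman p n - n + 1 - p := by rw [sSeq, v_eq_bellman h0 h1]

theorem sSeq_zero {p : ℝ} (h0 : 0 ≤ p) (h1 : p ≤ 1) : sSeq 0 p = 1 - p := by
  rw [sSeq_eq h0 h1]; simp [bellman]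

/-- `sSeq` as an average of the normalized best replies. -/
theorem sSeq_succ {p : ℝ} (h0 : 0 ≤ p) (h1 : p ≤ 1) (m : ℕ) :
    sSeq (m + 1) p = ∑ k ∈ Finset.range (m + 2), binomWeight p (m + 1) k *
      (bestReply p m k - (m + 1) + 1 - p) := by
  have h : ∀ k, binomWeight p (m + 1) k * (bestReply p m k - (m + 1) + 1 - p) =
      binomWeight p (m + 1) k * bestReply p m k +
        binomWeight p (m + 1) k * (-(m + 1) + 1 - p) := fun k => by ring
  simp_rw [h]
  rw [Finset.sum_add_distrib, ← Finset.sum_mul, sum_binomWeight, ← bellman_succ, sSeq_eq h0 h1]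
  push_cast; ring

theorem binomWeight_zero (p : ℝ) (n : ℕ) : binomWeight p n 0 = (1 - p) ^ n := by
  simp [binomWeight]

theorem binomWeight_self (p : ℝ) (n : ℕ) : binomWeight p n n = p ^ n := by
  simp [binomWeight]

theorem binomWeight_succ_self (p : ℝ) (n : ℕ) :
    binomWeight p (n + 1) n = (n + 1) * p ^ n * (1 - p) := by
  simp [binomWeight]; ring

theorem sum_binomWeight_mul (p x y z : ℝ) (m : ℕ) :
    ∑ k ∈ Finset.range (m + 2), binomWeight p (m + 1) k *
      (x + (if k = 0 then -1 else 0) + (if k = m then y else 0) + (if k = m + 1 then z else 0)) =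
    x - (1 - p) ^ (m + 1) + (m + 1) * p ^ m * (1 - p) * y + p ^ (m + 1) * z := by
  simp only [mul_add, Finset.sum_add_distrib, mul_ite, mul_zero, Finset.sum_ite_eq',
    ← Finset.sum_mul, Finset.mem_range]
  rw [sum_binomWeight, if_pos (by omega), if_pos (by omega), if_pos (by omega), binomWeight_zero,
    binomWeight_self, binomWeight_succ_self]
  ring

/-- Setting aside exactly one coin, a head if there is one, loses only when all coins land tails. -/
theorem sSeq_sub_le_succ {p : ℝ} (h0 : 0 ≤ p) (h1 : p ≤ 1) (m : ℕ) :
    sSeq m p - (1 - p) ^ (m + 1) ≤ sSeq (m + 1) p := by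
  rw [sSeq_succ h0 h1]
  have := sum_binomWeight_mul p (sSeq m p) 0 0 m
  rw [mul_zero, mul_zero, add_zero, add_zero] at this
  rw [← this]
  refine Finset.sum_le_sum fun k _ =>
    mul_le_mul_of_nonneg_left ?_ (binomWeight_nonneg h0 h1 _ _)
  have := le_bestReply p k (le_refl m)
  rw [Nat.add_sub_cancel_left] at this
  rw [sSeq_eq h0 h1]
  rcases Nat.eq_zero_or_pos k with rfl | hk
  · simp at this ⊢; linarith
  · rw [min_eq_left (by omega : 1 ≤ k)] at this
    simp [hk.ne'] at this ⊢; linarith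

theorem bellman_mono {p : ℝ} (h0 : 0 ≤ p) (h1 : p ≤ 1) : Monotone (bellman p) := by
  refine monotone_nat_of_le_succ fun m => ?_
  have h := sSeq_sub_le_succ h0 h1 m
  rw [sSeq_eq h0 h1, sSeq_eq h0 h1] at h
  have : (1 - p) ^ (m + 1) ≤ 1 := pow_le_one₀ (by linarith) (by linarith)
  push_cast at h
  linarith

theorem bellman_le {p : ℝ} (h0 : 0 ≤ p) (h1 : p ≤ 1) (n : ℕ) : bellman p n ≤ n := by
  induction n using Nat.strong_induction_on with
  | _ n ih =>
    rcases n with _ | m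
    · simp [bellman]
    · rw [bellman_succ, ← one_mul ((m + 1 : ℕ) : ℝ), ← sum_binomWeight p (m + 1), Finset.sum_mul]
      refine Finset.sum_le_sum fun k _ =>
        mul_le_mul_of_nonneg_left (bestReply_le fun j hj => ?_) (binomWeight_nonneg h0 h1 _ _)
      have h2 : ((min (m + 1 - j) k : ℕ) : ℝ) ≤ ((m + 1 - j : ℕ) : ℝ) := by
        exact_mod_cast min_le_left _ _
      rw [Nat.cast_sub (by omega)] at h2
      linarith [ih j (by omega)]

/-- Setting aside tails along with all `k` heads never beats setting aside just the heads, because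
`bellman` is monotone; so only `j ≥ m + 1 - k` has to be checked. -/
theorem bestReply_sub_le {p x : ℝ} (h0 : 0 ≤ p) (h1 : p ≤ 1) {m k : ℕ} (hk : 1 ≤ k)
    (hkm : k ≤ m + 1) (hx : ∀ j ≤ m, m + 1 ≤ j + k → sSeq j p ≤ x) :
    bestReply p m k - (m + 1) + 1 - p ≤ x := by
  suffices bestReply p m k ≤ x + (m + 1) - 1 + p by linarith
  refine bestReply_le fun j hj => ?_
  rcases le_total (m + 1) (j + k) with h | h
  · rw [min_eq_left (by omega), Nat.cast_sub (by omega)]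
    have := hx j hj h
    rw [sSeq_eq h0 h1] at this
    push_cast; linarith
  · rw [min_eq_right (by omega)]
    have := hx (m + 1 - k) (by omega) (by omega)
    rw [sSeq_eq h0 h1, Nat.cast_sub hkm] at this
    have h3 := bellman_mono h0 h1 (show j ≤ m + 1 - k by omega)
    push_cast at this; linarith

theorem bestReply_zero_le {p : ℝ} (h0 : 0 ≤ p) (h1 : p ≤ 1) (m : ℕ) :
    bestReply p m 0 - (m + 1) + 1 - p ≤ sSeq m p - 1 := by
  suffices bestReply p m 0 ≤ bellman p m by rw [sSeq_eq h0 h1]; linarith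
  refine bestReply_le fun j hj => ?_
  simpa using bellman_mono h0 h1 hj

theorem sSeq_le_bestReply_sub {p : ℝ} (h0 : 0 ≤ p) (h1 : p ≤ 1) {m k j : ℕ} (hj : j ≤ m)
    (hjk : m + 1 ≤ j + k) : sSeq j p ≤ bestReply p m k - (m + 1) + 1 - p := by
  have := le_bestReply p k hj
  rw [min_eq_left (by omega), Nat.cast_sub (by omega)] at this
  rw [sSeq_eq h0 h1]
  push_cast at this; linarith

theorem sSeq_one {p : ℝ} (h0 : 0 ≤ p) (h1 : p ≤ 1) : sSeq 1 p = 0 := by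
  have hb : ∀ k, bestReply p 0 k = (min 1 k : ℕ) := fun k => by
    obtain ⟨j, hj, h⟩ := exists_bestReply_eq p 0 k
    obtain rfl : j = 0 := by omega
    simpa [bellman] using h
  rw [sSeq_succ h0 h1]
  simp [Finset.sum_range_succ, hb, binomWeight]
  ring

/-- Improves the one-coin strategy by stopping at all heads, which is worth `sSeq 0 p = 1 - p`. No
monotonicity is needed. -/
theorem sub_add_le_sSeq_succ {p : ℝ} (h0 : 0 ≤ p) (h1 : p ≤ 1) (m : ℕ) :
    sSeq m p - (1 - p) ^ (m + 1) + p ^ (m + 1) * (1 - p - sSeq m p) ≤ sSeq (m + 1) p := by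
  rw [sSeq_succ h0 h1]
  have := sum_binomWeight_mul p (sSeq m p) 0 (1 - p - sSeq m p) m
  rw [mul_zero, add_zero] at this
  rw [← this]
  refine Finset.sum_le_sum fun k hk =>
    mul_le_mul_of_nonneg_left ?_ (binomWeight_nonneg h0 h1 _ _)
  rcases Nat.eq_zero_or_pos k with rfl | hk0
  · have := le_bestReply p 0 (le_refl m)
    simp at this ⊢
    rw [sSeq_eq h0 h1]; linarith
  · rcases eq_or_ne k (m + 1) with rfl | hne
    · have := sSeq_le_bestReply_sub h0 h1 (k := m + 1) (Nat.zero_le m) (by omega)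
      rw [sSeq_zero h0 h1] at this
      simpa using this
    · simpa [hk0.ne', hne] using sSeq_le_bestReply_sub h0 h1 (le_refl m) (by omega : m + 1 ≤ m + k)

/-- The exact recursion while the sequence is monotone from index `2` on and stays below
`1 - p`. -/
theorem sSeq_succ_eq {p : ℝ} (h0 : 0 ≤ p) (h1 : p ≤ 1) {m : ℕ} (hm : 1 ≤ m)
    (hmono : ∀ j, 2 ≤ j → j ≤ m → sSeq j p ≤ sSeq m p) (hq : sSeq m p ≤ 1 - p) :
    sSeq (m + 1) p = sSeq m p - (1 - p) ^ (m + 1) +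
      (m + 1) * p ^ m * (1 - p) * (max 0 (sSeq m p) - sSeq m p) +
      p ^ (m + 1) * (1 - p - sSeq m p) := by
  rw [sSeq_succ h0 h1, ← sum_binomWeight_mul]
  refine Finset.sum_congr rfl fun k hk => ?_
  congr 1
  rw [Finset.mem_range] at hk
  have hle1 : ∀ j ≤ m, 1 ≤ j → sSeq j p ≤ max 0 (sSeq m p) := fun j hj hj1 => by
    rcases hj1.eq_or_lt with rfl | hj2
    · rw [sSeq_one h0 h1]; exact le_max_left _ _
    · exact (hmono j hj2 hj).trans (le_max_right _ _)
  rcases Nat.eq_zero_or_pos k with rfl | hk0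
  · rw [if_pos rfl, if_neg (by omega), if_neg (by omega)]
    have := le_bestReply p 0 (le_refl m)
    have h2 := bestReply_zero_le h0 h1 m
    simp at this
    rw [sSeq_eq h0 h1] at h2 ⊢; linarith
  rw [if_neg hk0.ne']
  rcases eq_or_ne k (m + 1) with rfl | hne
  · rw [if_neg (by omega), if_pos rfl]
    have := sSeq_le_bestReply_sub h0 h1 (k := m + 1) (Nat.zero_le m) (by omega)
    rw [sSeq_zero h0 h1] at this
    have h2 := bestReply_sub_le h0 h1 (x := 1 - p) hk0 le_rfl fun j hj _ => by
      rcases Nat.eq_zero_or_pos j with rfl | hj0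
      · rw [sSeq_zero h0 h1]
      · exact (hle1 j hj hj0).trans (max_le (by linarith) hq)
    linarith
  rw [if_neg hne]
  rcases eq_or_ne k m with rfl | hne'
  -- With exactly one tail, keeping one coin is admissible and worth `sSeq 1 p = 0`; this produces
  -- the maximum with 0.
  · rw [if_pos rfl]
    have h2 := bestReply_sub_le h0 h1 (m := k) hk0 (by omega) fun j hj hjk => hle1 j hj (by omega)
    have h3 := max_le (a := 0)
      (by simpa [sSeq_one h0 h1] using
        sSeq_le_bestReply_sub h0 h1 (k := k) hm (by omega : k + 1 ≤ 1 + k))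
      (sSeq_le_bestReply_sub h0 h1 (k := k) (le_refl k) (by omega))
    linarith
  -- Two or more tails force `j ≥ 2`, so the exceptional indices 0 and 1 are out of reach.
  · rw [if_neg hne']
    have h2 := bestReply_sub_le h0 h1 (m := m) hk0 (by omega)
      fun j hj hjk => hmono j (by omega) hj
    have h3 := sSeq_le_bestReply_sub h0 h1 (k := k) (le_refl m) (by omega)
    linarith

/-! ### Existence of the limit and a positivity criterion -/

/-- The limit of `sSeq` exists. -/
theorem tendsto_sSeq {p : ℝ} (h0 : 0 < p) (h1 : p ≤ 1) :
    Tendsto (fun n : ℕ => sSeq n p) atTop (𝓝 (s p)) := by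
  suffices ∃ x, Tendsto (fun n : ℕ => sSeq n p) atTop (𝓝 x) by
    obtain ⟨x, hx⟩ := this
    rwa [s, hx.limUnder_eq]
  have hs : Summable fun i : ℕ => (1 - p) ^ (i + 1) :=
    (summable_nat_add_iff 1).2 (summable_geometric_of_lt_one (by linarith) (by linarith))
  have hq : ∀ i : ℕ, 0 ≤ (1 - p) ^ (i + 1) := fun i => pow_nonneg (by linarith) _
  -- Adding back the summable all-tails losses makes the sequence monotone.
  have hmono : Monotone fun n : ℕ => sSeq n p + ∑ i ∈ Finset.range n, (1 - p) ^ (i + 1) := by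
    refine monotone_nat_of_le_succ fun n => ?_
    rw [Finset.sum_range_succ]
    linarith [sSeq_sub_le_succ h0.le h1 n]
  have hbdd : BddAbove (Set.range fun n : ℕ =>
      sSeq n p + ∑ i ∈ Finset.range n, (1 - p) ^ (i + 1)) := by
    refine ⟨1 - p + ∑' i : ℕ, (1 - p) ^ (i + 1), ?_⟩
    rintro _ ⟨n, rfl⟩
    have := hs.sum_le_tsum (Finset.range n) fun i _ => hq i
    have h2 := bellman_le h0.le h1 n
    simp only [sSeq_eq h0.le h1]
    linarith
  have := (tendsto_atTop_ciSup hmono hbdd).sub hs.hasSum.tendsto_sum_nat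
  exact ⟨_, by simpa using this⟩

/-- The product of the factors 1 - u_k stays away from 0 when Σ u_k converges. Past an index where
the tail sum is below 1/2, it is at least 1 - Σ u_k > 1/2. -/
theorem pos_of_tendsto_of_one_sub_mul_le {x u : ℕ → ℝ} {X : ℝ} {m : ℕ} (hu : Summable u)
    (hu0 : ∀ k, 0 ≤ u k) (hu1 : ∀ k, u k < 1) (hx : ∀ k, m ≤ k → (1 - u k) * x k ≤ x (k + 1))
    (hm : 0 < x m) (hX : Tendsto x atTop (𝓝 X)) : 0 < X := by
  have hpos : ∀ k, m ≤ k → 0 < x k := fun k hk => by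
    induction k, hk using Nat.le_induction with
    | base => exact hm
    | succ k hk ih => exact (mul_pos (by linarith [hu1 k]) ih).trans_le (hx k hk)
  obtain ⟨N, hN, hmN⟩ := (((tendsto_sum_nat_add u).eventually_lt_const
    (show (0 : ℝ) < 1 / 2 by norm_num)).and (eventually_ge_atTop m)).exists
  have hbound : ∀ j, (1 - ∑ i ∈ Finset.range j, u (i + N)) * x N ≤ x (j + N) := fun j => by
    induction j with
    | zero => simp
    | succ j ih =>
      have h1 := hx (j + N) (by omega)
      have h2 := mul_le_mul_of_nonneg_left ih (by linarith [hu1 (j + N)] : 0 ≤ 1 - u (j + N))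
      have h3 : 0 ≤ u (j + N) * (∑ i ∈ Finset.range j, u (i + N)) * x N :=
        mul_nonneg (mul_nonneg (hu0 _) (Finset.sum_nonneg fun i _ => hu0 _)) (hpos N hmN).le
      rw [Finset.sum_range_succ, show j + 1 + N = j + N + 1 by omega]
      linarith
  have hle : ∀ j, x N / 2 ≤ x (j + N) := fun j => by
    refine le_trans ?_ (hbound j)
    have := ((summable_nat_add_iff N).2 hu).sum_le_tsum (Finset.range j) fun i _ => hu0 _
    nlinarith [hpos N hmN]
  have := ge_of_tendsto' ((tendsto_add_atTop_iff_nat N).2 hX) hle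
  linarith [hpos N hmN]

/-! ### The linear recursion and uniform bounds -/

/-- The probability that at least `k + 1` of `k + 2` coins land heads. -/
noncomputable def decay (k : ℕ) (p : ℝ) : ℝ := p ^ (k + 2) + (k + 2) * p ^ (k + 1) * (1 - p)

/-- All heads contribute `1 - p`, all tails cost 1. -/
noncomputable def drift (k : ℕ) (p : ℝ) : ℝ := p ^ (k + 2) * (1 - p) - (1 - p) ^ (k + 2)

/-- The linear recursion that `sSeq (k + 1)` obeys as long as it is nonpositive. -/
noncomputable def linSeq : ℕ → ℝ → ℝ
  | 0, _ => 0
  | k + 1, p => linSeq k p + (drift k p - decay k p * linSeq k p)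

theorem linSeq_succ (k : ℕ) (p : ℝ) :
    linSeq (k + 1) p = (1 - decay k p) * linSeq k p + drift k p := by rw [linSeq]; ring

theorem decay_nonneg {p : ℝ} (h0 : 0 ≤ p) (h1 : p ≤ 1) (k : ℕ) : 0 ≤ decay k p := by
  have : 0 ≤ 1 - p := by linarith
  unfold decay; positivity

theorem decay_le {p : ℝ} (h0 : 0 ≤ p) (k : ℕ) : decay k p ≤ 1 - (1 - p) ^ 2 := by
  induction k with
  | zero => unfold decay; norm_num; nlinarith
  | succ k ih =>
    -- This is `decay k p - decay (k + 1) p`; equality holds in the bound at `k = 0`.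
    have : 0 ≤ ((k : ℝ) + 2) * p ^ (k + 1) * (1 - p) ^ 2 := by positivity
    unfold decay at *
    push_cast
    linear_combination ih + this

theorem decay_lt_one {p : ℝ} (h0 : 0 ≤ p) (h1 : p < 1) (k : ℕ) : decay k p < 1 := by
  have := decay_le h0 k
  have h2 : 0 < (1 - p) ^ 2 := pow_pos (by linarith) 2
  linarith

/-- A summable majorant for the coefficients of the recursion and their derivatives. -/
noncomputable def majorant (k : ℕ) : ℝ := ((k : ℝ) + 2) ^ 2 * (3 / 4) ^ k

theorem majorant_nonneg (k : ℕ) : 0 ≤ majorant k := by unfold majorant; positivity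

theorem summable_majorant : Summable majorant := by
  have h := (summable_nat_add_iff 2).2
    (summable_pow_mul_geometric_of_norm_lt_one 2 (r := (3 / 4 : ℝ)) (by norm_num))
  refine (h.mul_left (16 / 9)).congr fun k => ?_
  unfold majorant
  push_cast
  ring

section Bounds

variable {p : ℝ}

theorem pow_le_geometric (h0 : 0 ≤ p) (h1 : p ≤ 3 / 4) (k i : ℕ) : p ^ (k + i) ≤ (3 / 4) ^ k := by
  rw [pow_add]
  exact (mul_le_of_le_one_right (by positivity) (pow_le_one₀ h0 (by linarith))).trans
    (pow_le_pow_left₀ h0 h1 k)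

theorem mul_pow_le_majorant (h0 : 0 ≤ p) (h1 : p ≤ 3 / 4) (k i : ℕ) :
    ((k : ℝ) + 2) * p ^ (k + i) ≤ majorant k / 2 := by
  have := pow_le_geometric h0 h1 k i
  have h3 : (0 : ℝ) ≤ (3 / 4) ^ k := by positivity
  have hk : (0 : ℝ) ≤ k := by positivity
  unfold majorant
  nlinarith [mul_nonneg (mul_nonneg hk (by linarith : (0 : ℝ) ≤ k + 2)) h3]

theorem decay_le_majorant (h0 : 0 ≤ p) (h1 : p ≤ 3 / 4) (k : ℕ) : decay k p ≤ majorant k := by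
  have h2 := mul_pow_le_majorant h0 h1 k 2
  have h3 := mul_pow_le_majorant h0 h1 k 1
  have h4 : 0 ≤ p ^ (k + 2) := by positivity
  have h5 : 0 ≤ ((k : ℝ) + 2) * p ^ (k + 1) := by positivity
  have hk : (0 : ℝ) ≤ k := by positivity
  unfold decay
  nlinarith

theorem summable_decay (h0 : 0 ≤ p) (h1 : p ≤ 3 / 4) : Summable fun k => decay k p :=
  summable_majorant.of_nonneg_of_le (decay_nonneg h0 (by linarith)) (decay_le_majorant h0 h1)

theorem abs_drift_le (h0 : 1 / 4 ≤ p) (h1 : p ≤ 3 / 4) (k : ℕ) : |drift k p| ≤ majorant k := by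
  have h2 := mul_pow_le_majorant (by linarith : 0 ≤ p) h1 k 2
  have h3 := mul_pow_le_majorant (by linarith : 0 ≤ 1 - p) (by linarith) k 2
  have h4 : 0 ≤ p ^ (k + 2) := by positivity
  have h5 : 0 ≤ (1 - p) ^ (k + 2) := pow_nonneg (by linarith) _
  have hk : (0 : ℝ) ≤ k := by positivity
  have := majorant_nonneg k
  unfold drift
  rw [abs_le]
  constructor <;> nlinarith

theorem abs_linSeq_le (h0 : 1 / 4 ≤ p) (h1 : p ≤ 3 / 4) (k : ℕ) :
    |linSeq k p| ≤ ∑' i, majorant i := by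
  refine le_trans ?_ (summable_majorant.sum_le_tsum (Finset.range k) fun i _ => majorant_nonneg i)
  induction k with
  | zero => simp [linSeq]
  | succ k ih =>
    rw [linSeq_succ, Finset.sum_range_succ]
    have h2 := decay_nonneg (by linarith : 0 ≤ p) (by linarith) k
    have h3 := decay_lt_one (by linarith : 0 ≤ p) (by linarith) k
    refine (abs_add_le _ _).trans (add_le_add ?_ (abs_drift_le h0 h1 k))
    rw [abs_mul, abs_of_nonneg (by linarith : 0 ≤ 1 - decay k p)]
    nlinarith [abs_nonneg (linSeq k p)]

end Bounds

/-! ### Differentiation in p of the linear recursion and its limit -/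

section Derivative

noncomputable def driftDeriv (k : ℕ) (p : ℝ) : ℝ :=
  (k + 2) * p ^ (k + 1) * (1 - p) - p ^ (k + 2) + (k + 2) * (1 - p) ^ (k + 1)

noncomputable def decayDeriv (k : ℕ) (p : ℝ) : ℝ := (k + 2) * (k + 1) * p ^ k * (1 - p)

noncomputable def linSeqDeriv : ℕ → ℝ → ℝ
  | 0, _ => 0
  | k + 1, p => linSeqDeriv k p +
      (driftDeriv k p - (decayDeriv k p * linSeq k p + decay k p * linSeqDeriv k p))

theorem hasDerivAt_drift (k : ℕ) (p : ℝ) : HasDerivAt (drift k) (driftDeriv k p) p := by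
  have h1 := (hasDerivAt_id p).const_sub 1
  have h2 := ((hasDerivAt_pow (k + 2) p).mul h1).sub (h1.pow (k + 2))
  refine (h2.congr_deriv ?_).congr_of_eventuallyEq (Eventually.of_forall fun x => ?_)
  · simp [driftDeriv]; ring
  · simp [drift]

theorem hasDerivAt_decay (k : ℕ) (p : ℝ) : HasDerivAt (decay k) (decayDeriv k p) p := by
  have h1 := (hasDerivAt_id p).const_sub 1
  have h2 := (hasDerivAt_pow (k + 2) p).add
    (((hasDerivAt_pow (k + 1) p).const_mul ((k : ℝ) + 2)).mul h1)
  refine (h2.congr_deriv ?_).congr_of_eventuallyEq (Eventually.of_forall fun x => ?_)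
  · simp only [Nat.add_sub_cancel, Nat.add_succ_sub_one, id, decayDeriv]
    push_cast; ring
  · simp [decay]

theorem hasDerivAt_linSeq (k : ℕ) (p : ℝ) : HasDerivAt (linSeq k) (linSeqDeriv k p) p := by
  induction k with
  | zero => exact hasDerivAt_const p 0
  | succ k ih =>
    exact ih.add ((hasDerivAt_drift k p).sub ((hasDerivAt_decay k p).mul ih))

variable {p : ℝ}

theorem decayDeriv_nonneg (h0 : 0 ≤ p) (h1 : p ≤ 1) (k : ℕ) : 0 ≤ decayDeriv k p := by
  have : 0 ≤ 1 - p := by linarith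
  unfold decayDeriv; positivity

theorem decayDeriv_le (h0 : 0 ≤ p) (h1 : p ≤ 3 / 4) (k : ℕ) : decayDeriv k p ≤ majorant k := by
  have h2 := pow_le_geometric h0 h1 k 0
  rw [add_zero] at h2
  have hk : (0 : ℝ) ≤ k := by positivity
  have h3 : ((k : ℝ) + 2) * (k + 1) * p ^ k ≤ ((k : ℝ) + 2) ^ 2 * (3 / 4) ^ k :=
    mul_le_mul (by nlinarith) h2 (by positivity) (by positivity)
  have h4 : 0 ≤ ((k : ℝ) + 2) * (k + 1) * p ^ k := by positivity
  unfold decayDeriv majorant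
  nlinarith

theorem abs_driftDeriv_le (h0 : 1 / 4 ≤ p) (h1 : p ≤ 3 / 4) (k : ℕ) :
    |driftDeriv k p| ≤ majorant k := by
  have h2 := mul_pow_le_majorant (by linarith : 0 ≤ p) h1 k 1
  have h3 := mul_pow_le_majorant (by linarith : 0 ≤ 1 - p) (by linarith) k 1
  have h6 := mul_pow_le_majorant (by linarith : 0 ≤ p) h1 k 2
  have h4 : 0 ≤ p ^ (k + 2) := by positivity
  have h5 : 0 ≤ ((k : ℝ) + 2) * (1 - p) ^ (k + 1) :=
    mul_nonneg (by positivity) (pow_nonneg (by linarith) _)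
  have h7 : 0 ≤ ((k : ℝ) + 2) * p ^ (k + 1) := by positivity
  have hk : (0 : ℝ) ≤ k := by positivity
  have h8 : ((k : ℝ) + 2) * p ^ (k + 1) * (1 - p) ≤ ((k : ℝ) + 2) * p ^ (k + 1) :=
    mul_le_of_le_one_right h7 (by linarith)
  have h9 : 0 ≤ ((k : ℝ) + 2) * p ^ (k + 1) * (1 - p) := mul_nonneg h7 (by linarith)
  have h10 : p ^ (k + 2) ≤ ((k : ℝ) + 2) * p ^ (k + 2) := le_mul_of_one_le_left h4 (by linarith)
  have := majorant_nonneg k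
  unfold driftDeriv
  rw [abs_le]
  constructor <;> linarith

/-- A bound for `linSeqDeriv` on `[1/4, 3/4]`. -/
noncomputable def derivBound : ℝ := (1 + ∑' i, majorant i) * ∑' i, majorant i

theorem tsum_majorant_nonneg : 0 ≤ ∑' i, majorant i := tsum_nonneg majorant_nonneg

theorem derivBound_nonneg : 0 ≤ derivBound := by
  have := tsum_majorant_nonneg
  unfold derivBound; positivity

theorem abs_decayDeriv_mul_linSeq_le (h0 : 1 / 4 ≤ p) (h1 : p ≤ 3 / 4) (k : ℕ) :
    |decayDeriv k p * linSeq k p| ≤ majorant k * ∑' i, majorant i := by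
  rw [abs_mul, abs_of_nonneg (decayDeriv_nonneg (by linarith) (by linarith) k)]
  exact mul_le_mul (decayDeriv_le (by linarith) h1 k) (abs_linSeq_le h0 h1 k) (abs_nonneg _)
    (majorant_nonneg k)

theorem abs_linSeqDeriv_le (h0 : 1 / 4 ≤ p) (h1 : p ≤ 3 / 4) (k : ℕ) :
    |linSeqDeriv k p| ≤ derivBound := by
  refine le_trans ?_ (mul_le_mul_of_nonneg_left
    (summable_majorant.sum_le_tsum (Finset.range k) fun i _ => majorant_nonneg i)
    (by linarith [tsum_majorant_nonneg]))
  induction k with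
  | zero => simp [linSeqDeriv]
  | succ k ih =>
    have h2 := decay_nonneg (by linarith : 0 ≤ p) (by linarith) k
    have h3 := decay_lt_one (by linarith : 0 ≤ p) (by linarith) k
    have h4 := abs_driftDeriv_le h0 h1 k
    have h5 := abs_decayDeriv_mul_linSeq_le h0 h1 k
    have h6 : |(1 - decay k p) * linSeqDeriv k p| ≤
        (1 + ∑' i, majorant i) * ∑ i ∈ Finset.range k, majorant i := by
      rw [abs_mul, abs_of_nonneg (by linarith : 0 ≤ 1 - decay k p)]
      exact (mul_le_of_le_one_left (abs_nonneg _) (by linarith)).trans ih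
    rw [Finset.sum_range_succ, linSeqDeriv]
    rw [abs_le] at *
    constructor <;> linarith [h6.1, h6.2, h4.1, h4.2, h5.1, h5.2]

/-- The limit of `linSeq`. -/
noncomputable def linLim (p : ℝ) : ℝ := ∑' k, (drift k p - decay k p * linSeq k p)

noncomputable def linLimDeriv (p : ℝ) : ℝ :=
  ∑' k, (driftDeriv k p - (decayDeriv k p * linSeq k p + decay k p * linSeqDeriv k p))

theorem linSeq_eq_sum (k : ℕ) (p : ℝ) :
    linSeq k p = ∑ i ∈ Finset.range k, (drift i p - decay i p * linSeq i p) := by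
  induction k with
  | zero => simp [linSeq]
  | succ k ih => rw [Finset.sum_range_succ, linSeq, ← ih]

theorem linSeqDeriv_eq_sum (k : ℕ) (p : ℝ) :
    linSeqDeriv k p = ∑ i ∈ Finset.range k,
      (driftDeriv i p - (decayDeriv i p * linSeq i p + decay i p * linSeqDeriv i p)) := by
  induction k with
  | zero => simp [linSeqDeriv]
  | succ k ih => rw [Finset.sum_range_succ, linSeqDeriv, ← ih]

theorem summable_linSeq_increments (h0 : 1 / 4 ≤ p) (h1 : p ≤ 3 / 4) :
    Summable fun k => drift k p - decay k p * linSeq k p := by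
  refine Summable.of_norm_bounded (summable_majorant.mul_left (1 + ∑' i, majorant i)) fun k => ?_
  have h2 : |decay k p * linSeq k p| ≤ majorant k * ∑' i, majorant i := by
    rw [abs_mul, abs_of_nonneg (decay_nonneg (by linarith) (by linarith) k)]
    exact mul_le_mul (decay_le_majorant (by linarith) h1 k) (abs_linSeq_le h0 h1 k)
      (abs_nonneg _) (majorant_nonneg k)
  have := abs_sub (drift k p) (decay k p * linSeq k p)
  rw [Real.norm_eq_abs]
  linarith [abs_drift_le h0 h1 k]

theorem norm_linSeqDeriv_increment_le (h0 : 1 / 4 ≤ p) (h1 : p ≤ 3 / 4) (k : ℕ) :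
    ‖driftDeriv k p - (decayDeriv k p * linSeq k p + decay k p * linSeqDeriv k p)‖ ≤
      (1 + ∑' i, majorant i + derivBound) * majorant k := by
  have h2 : |decay k p * linSeqDeriv k p| ≤ majorant k * derivBound := by
    rw [abs_mul, abs_of_nonneg (decay_nonneg (by linarith) (by linarith) k)]
    exact mul_le_mul (decay_le_majorant (by linarith) h1 k) (abs_linSeqDeriv_le h0 h1 k)
      (abs_nonneg _) (majorant_nonneg k)
  have h3 := abs_sub (driftDeriv k p) (decayDeriv k p * linSeq k p + decay k p * linSeqDeriv k p)
  have h4 := abs_add_le (decayDeriv k p * linSeq k p) (decay k p * linSeqDeriv k p)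
  rw [Real.norm_eq_abs]
  linarith [abs_driftDeriv_le h0 h1 k, abs_decayDeriv_mul_linSeq_le h0 h1 k]

theorem tendsto_linSeq (h0 : 1 / 4 ≤ p) (h1 : p ≤ 3 / 4) :
    Tendsto (fun k => linSeq k p) atTop (𝓝 (linLim p)) := by
  exact (summable_linSeq_increments h0 h1).hasSum.tendsto_sum_nat.congr
    fun k => (linSeq_eq_sum k p).symm

theorem tendsto_linSeqDeriv (h0 : 1 / 4 ≤ p) (h1 : p ≤ 3 / 4) :
    Tendsto (fun k => linSeqDeriv k p) atTop (𝓝 (linLimDeriv p)) := by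
  exact (Summable.of_norm_bounded (summable_majorant.mul_left _)
    (norm_linSeqDeriv_increment_le h0 h1)).hasSum.tendsto_sum_nat.congr
      fun k => (linSeqDeriv_eq_sum k p).symm

theorem hasDerivAt_linLim (h0 : 1 / 4 < p) (h1 : p < 3 / 4) :
    HasDerivAt linLim (linLimDeriv p) p :=
  hasDerivAt_tsum_of_isPreconnected
    (summable_majorant.mul_left (1 + ∑' i, majorant i + derivBound))
    (t := Set.Ioo (1 / 4) (3 / 4)) isOpen_Ioo isPreconnected_Ioo
    (fun k x _ => (hasDerivAt_drift k x).sub ((hasDerivAt_decay k x).mul (hasDerivAt_linSeq k x)))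
    (fun k _ hx => norm_linSeqDeriv_increment_le hx.1.le hx.2.le k) ⟨h0, h1⟩
    (summable_linSeq_increments h0.le h1.le) ⟨h0, h1⟩

/-- Uniformity in `k` is what matters: near a zero of `linLim` it bounds every positive excursion of
`linSeq` by a multiple of the distance. -/
theorem abs_linSeq_sub_le {x y : ℝ} (hx : x ∈ Set.Icc (1 / 4 : ℝ) (3 / 4))
    (hy : y ∈ Set.Icc (1 / 4 : ℝ) (3 / 4)) (k : ℕ) :
    |linSeq k y - linSeq k x| ≤ derivBound * |y - x| :=
  (convex_Icc _ _).norm_image_sub_le_of_norm_hasDerivWithin_le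
    (fun z _ => (hasDerivAt_linSeq k z).hasDerivWithinAt)
    (fun _ hz => abs_linSeqDeriv_le hz.1 hz.2 k) hx hy

theorem driftDeriv_nonneg (h0 : 0 ≤ p) (h1 : p ≤ 5 / 8) (k : ℕ) : 0 ≤ driftDeriv k p := by
  have h2 : 0 ≤ (1 - p) ^ (k + 1) := pow_nonneg (by linarith) _
  have h3 : 0 ≤ p ^ (k + 1) * ((k + 2) * (1 - p) - p) :=
    mul_nonneg (by positivity) (by nlinarith [(Nat.cast_nonneg k : (0 : ℝ) ≤ k)])
  have h4 : 0 ≤ ((k : ℝ) + 2) * (1 - p) ^ (k + 1) := by positivity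
  unfold driftDeriv
  linear_combination h3 + h4

theorem drift_mono {x y : ℝ} (h0 : 0 ≤ x) (hxy : x ≤ y) (h1 : y ≤ 5 / 8) (k : ℕ) :
    drift k x ≤ drift k y := by
  refine monotoneOn_of_hasDerivWithinAt_nonneg (convex_Icc 0 (5 / 8))
    (fun z _ => (hasDerivAt_drift k z).continuousAt.continuousWithinAt)
    (fun z _ => (hasDerivAt_drift k z).hasDerivWithinAt) (fun z hz => ?_)
    ⟨h0, hxy.trans h1⟩ ⟨h0.trans hxy, h1⟩ hxy
  have := interior_subset hz
  exact driftDeriv_nonneg this.1 this.2 k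

theorem decay_mono {x y : ℝ} (h0 : 0 ≤ x) (hxy : x ≤ y) (h1 : y ≤ 1) (k : ℕ) :
    decay k x ≤ decay k y := by
  refine monotoneOn_of_hasDerivWithinAt_nonneg (convex_Icc 0 1)
    (fun z _ => (hasDerivAt_decay k z).continuousAt.continuousWithinAt)
    (fun z _ => (hasDerivAt_decay k z).hasDerivWithinAt) (fun z hz => ?_)
    ⟨h0, hxy.trans h1⟩ ⟨h0.trans hxy, h1⟩ hxy
  have := interior_subset hz
  exact decayDeriv_nonneg this.1 this.2 k

end Derivative

/-! ### Signs and monotonicity of the linear limit -/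

section Signs

variable {p : ℝ}

/-- `drift (k + 1) p = p * drift k p + (2 * p - 1) * (1 - p) ^ (k + 2)`. -/
theorem drift_pos_succ (h0 : 1 / 2 < p) (h1 : p < 1) {k : ℕ} (h : 0 ≤ drift k p) :
    0 < drift (k + 1) p := by
  have h2 : 0 < (1 - p) ^ (k + 2) := pow_pos (by linarith) _
  unfold drift at *
  have h3 : 0 < (1 - p) ^ (k + 2) * (2 * p - 1) := mul_pos h2 (by linarith)
  have h4 := mul_nonneg (by linarith : 0 ≤ p) h
  rw [pow_succ p (k + 2), pow_succ (1 - p) (k + 2)]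
  linear_combination h3 + h4

theorem drift_pos_of_le (h0 : 1 / 2 < p) (h1 : p < 1) {k : ℕ} (h : 0 ≤ drift k p) {j : ℕ}
    (hj : k < j) : 0 < drift j p := by
  induction j, hj using Nat.le_induction with
  | base => exact drift_pos_succ h0 h1 h
  | succ j _ ih => exact drift_pos_succ h0 h1 ih.le

/-- If the linear recursion reaches a nonnegative value, its limit is positive. -/
theorem linLim_pos (h0 : 1 / 2 < p) (h1 : p ≤ 3 / 4) {k : ℕ} (hk : 1 ≤ k)
    (h : 0 ≤ linSeq k p) : 0 < linLim p := by
  have hex : ∃ k, 0 ≤ linSeq (k + 1) p := ⟨k - 1, by rwa [Nat.sub_add_cancel hk]⟩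
  classical
  set i := Nat.find hex with hi
  have hspec : 0 ≤ linSeq (i + 1) p := Nat.find_spec hex
  have hprev : linSeq i p ≤ 0 := by
    rcases Nat.eq_zero_or_pos i with h2 | h2
    · rw [h2]; simp [linSeq]
    · have := Nat.find_min hex (m := i - 1) (by omega)
      rw [Nat.sub_add_cancel h2] at this
      exact (not_le.1 this).le
  have hd : ∀ j, decay j p < 1 := decay_lt_one (by linarith) (by linarith)
  -- At the first crossing a nonpositive value becomes nonnegative, which only a nonnegative drift
  -- can do; from then on the drift stays positive.
  have hdrift : 0 ≤ drift i p := by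
    rw [linSeq_succ] at hspec
    nlinarith [hd i]
  have hpos : ∀ j, i < j → 0 < drift j p := fun j => drift_pos_of_le h0 (by linarith) hdrift
  refine pos_of_tendsto_of_one_sub_mul_le (m := i + 2) (summable_decay (by linarith) h1)
    (decay_nonneg (by linarith) (by linarith)) hd (fun j hj => ?_) ?_
    (tendsto_linSeq (by linarith) h1)
  · rw [linSeq_succ]; linarith [hpos j (by omega)]
  · rw [linSeq_succ]
    have := mul_nonneg (by linarith [hd (i + 1)] : 0 ≤ 1 - decay (i + 1) p) hspec
    linarith [hpos (i + 1) (by omega)]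

theorem linLim_five_eighths_pos : 0 < linLim (5 / 8) :=
  linLim_pos (by norm_num) (by norm_num) le_rfl
    (by simp [linSeq, drift, decay]; norm_num)

theorem linLim_half_neg : linLim (1 / 2) < 0 := by
  have := pos_of_tendsto_of_one_sub_mul_le (m := 1) (x := fun k => -linSeq k (1 / 2))
    (summable_decay (p := 1 / 2) (by norm_num) (by norm_num))
    (decay_nonneg (by norm_num) (by norm_num)) (decay_lt_one (by norm_num) (by norm_num))
    (fun k _ => ?_) (by simp [linSeq, drift, decay]; norm_num)
    (tendsto_linSeq (by norm_num) (by norm_num)).neg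
  · linarith
  · have h : drift k (1 / 2) ≤ 0 := by
      unfold drift
      have : (0 : ℝ) < (1 / 2) ^ (k + 2) := by positivity
      norm_num at this ⊢
    simp only [linSeq_succ]
    linarith

/-- The difference of the two recursions has source `drift k y - drift k x` plus `(decay k x - decay
k y) * linSeq k y`; both are nonnegative because `linSeq k y ≤ 0`. -/
theorem linSeq_sub_step {x y : ℝ} (h0 : 0 ≤ x) (hxy : x ≤ y) (h1 : y ≤ 5 / 8) {k : ℕ}
    (hy : linSeq k y ≤ 0) :
    (1 - decay k x) * (linSeq k y - linSeq k x) ≤ linSeq (k + 1) y - linSeq (k + 1) x := by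
  have h2 := drift_mono h0 hxy h1 k
  have h3 := decay_mono h0 hxy (by linarith) k
  rw [linSeq_succ, linSeq_succ]
  nlinarith [mul_nonneg (sub_nonneg.2 h3) (neg_nonneg.2 hy)]

/-- Monotonicity in `p` as long as the recursion stays nonpositive. -/
theorem linSeq_le_linSeq {x y : ℝ} (h0 : 0 ≤ x) (hxy : x ≤ y) (h1 : y ≤ 5 / 8)
    (hy : ∀ k, linSeq k y ≤ 0) (k : ℕ) : linSeq k x ≤ linSeq k y := by
  induction k with
  | zero => simp [linSeq]
  | succ k ih =>
    have h2 := linSeq_sub_step h0 hxy h1 (hy k)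
    have h3 := decay_lt_one (p := x) h0 (by linarith) k
    nlinarith

theorem linLim_lt_linLim {x y : ℝ} (h0 : 1 / 4 ≤ x) (hxy : x < y) (h1 : y ≤ 5 / 8)
    (hy : ∀ k, linSeq k y ≤ 0) : linLim x < linLim y := by
  have := pos_of_tendsto_of_one_sub_mul_le (m := 1) (x := fun k => linSeq k y - linSeq k x)
    (summable_decay (p := x) (by linarith) (by linarith))
    (decay_nonneg (by linarith) (by linarith)) (decay_lt_one (by linarith) (by linarith))
    (fun k _ => linSeq_sub_step (by linarith) hxy.le h1 (hy k)) ?_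
    ((tendsto_linSeq (by linarith) (by linarith)).sub
      (tendsto_linSeq (by linarith) (by linarith)))
  · linarith
  · have h2 : 0 < (y - x) * (2 - (y ^ 2 + x * y + x ^ 2)) :=
      mul_pos (by linarith) (by nlinarith)
    simp only [linSeq, drift]
    linear_combination h2

theorem exists_linLim_eq_zero : ∃ p ∈ Set.Ioo (1 / 2 : ℝ) (5 / 8), linLim p = 0 := by
  have hc : ContinuousOn linLim (Set.Icc (1 / 2) (5 / 8)) := fun x hx =>
    (hasDerivAt_linLim (by linarith [hx.1]) (by linarith [hx.2])).continuousAt.continuousWithinAt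
  obtain ⟨p, hp, h⟩ := intermediate_value_Ioo (by norm_num) hc
    ⟨linLim_half_neg, linLim_five_eighths_pos⟩
  exact ⟨p, hp, h⟩

theorem linSeq_neg (h0 : 1 / 2 < p) (h1 : p ≤ 3 / 4) (h : linLim p ≤ 0) {k : ℕ}
    (hk : 1 ≤ k) : linSeq k p < 0 := by
  by_contra! h2
  exact h.not_gt (linLim_pos h0 h1 hk h2)

theorem linSeq_nonpos (h0 : 1 / 2 < p) (h1 : p ≤ 3 / 4) (h : linLim p ≤ 0) (k : ℕ) :
    linSeq k p ≤ 0 := by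
  rcases Nat.eq_zero_or_pos k with rfl | hk
  · simp [linSeq]
  · exact (linSeq_neg h0 h1 h hk).le

/-- Infinitesimal form of `linSeq_sub_step`, started from `driftDeriv 0 p = 2 - 3 * p ^ 2 > 0`. -/
theorem linLimDeriv_pos (h0 : 1 / 2 < p) (h1 : p ≤ 5 / 8) (h : linLim p ≤ 0) :
    0 < linLimDeriv p := by
  refine pos_of_tendsto_of_one_sub_mul_le (m := 1)
    (summable_decay (p := p) (by linarith) (by linarith))
    (decay_nonneg (by linarith) (by linarith)) (decay_lt_one (by linarith) (by linarith))
    (fun k _ => ?_) ?_ (tendsto_linSeqDeriv (p := p) (by linarith) (by linarith))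
  · have h2 := driftDeriv_nonneg (by linarith) h1 k
    have h3 := mul_nonneg (decayDeriv_nonneg (p := p) (by linarith) (by linarith) k)
      (neg_nonneg.2 (linSeq_nonpos h0 (by linarith) h k))
    rw [linSeqDeriv]
    linarith
  · simp only [linSeqDeriv, driftDeriv, linSeq]
    norm_num
    nlinarith

end Signs

/-! ### The exact recursion on [1/2, 5/8] and comparison with the linear one -/

section Exact

variable {p : ℝ}

/-- The invariant that makes `sSeq (k + 1)` increase at index `k`. -/
def Increases (p : ℝ) (k : ℕ) (x : ℝ) : Prop :=
  (x ≤ 0 ∧ (1 - p) ^ (k + 2) ≤ p ^ (k + 2) * (1 - p - x) - (k + 2) * p ^ (k + 1) * (1 - p) * x) ∨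
  (0 ≤ x ∧ (1 - p) ^ (k + 2) ≤ p ^ (k + 2) * (1 - p - x))

/-- One step of the recursion of `sSeq`. -/
noncomputable def step (p : ℝ) (k : ℕ) (x : ℝ) : ℝ :=
  x - (1 - p) ^ (k + 2) + (k + 2) * p ^ (k + 1) * (1 - p) * (max 0 x - x) +
    p ^ (k + 2) * (1 - p - x)

theorem step_eq (p : ℝ) (k : ℕ) (x : ℝ) :
    step p k x = (1 - decay k p) * x + drift k p +
      (k + 2) * p ^ (k + 1) * (1 - p) * max 0 x := by
  unfold step decay drift; ring

theorem Increases.le_step {k : ℕ} {x : ℝ} (h : Increases p k x) : x ≤ step p k x := by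
  unfold step
  rcases h with ⟨hx, h⟩ | ⟨hx, h⟩
  · rw [max_eq_left hx]; linarith
  · rw [max_eq_right hx]; linarith

theorem Increases.le_one_sub {k : ℕ} {x : ℝ} (h0 : 0 < p) (h1 : p ≤ 1) (h : Increases p k x) :
    x ≤ 1 - p := by
  rcases h with ⟨hx, -⟩ | ⟨-, h⟩
  · linarith
  · have h2 : 0 ≤ (1 - p) ^ (k + 2) := pow_nonneg (by linarith) _
    have := nonneg_of_mul_nonneg_right (h2.trans h) (pow_pos h0 _)
    linarith

/-- Crossing zero preserves the invariant. -/
theorem increases_of_step_nonneg (h0 : 1 / 2 ≤ p) (h1 : p < 1) {k : ℕ} {x : ℝ} (hx : x ≤ 0)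
    (h : 0 ≤ step p k x) : Increases p (k + 1) (step p k x) := by
  refine Or.inr ⟨h, ?_⟩
  rw [step_eq, max_eq_left hx, mul_zero, add_zero] at *
  -- Since `x ≤ 0`, the new value is at most `drift k p`, and the claim is checked with that bound.
  have h2 := mul_nonneg (by linarith [decay_lt_one (by linarith : 0 ≤ p) h1 k] :
    0 ≤ 1 - decay k p) (neg_nonneg.2 hx)
  have hd : 0 ≤ drift k p := by linarith
  have hP : 0 ≤ p ^ (k + 2) := by positivity
  have hQ : 0 ≤ (1 - p) ^ (k + 2) := pow_nonneg (by linarith) _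
  have hP1 : p ^ (k + 2) ≤ 1 := pow_le_one₀ (by linarith) h1.le
  have h3 := mul_nonneg (mul_nonneg (by linarith : 0 ≤ p) hP) h2
  have h4 := mul_nonneg (mul_nonneg (by linarith : 0 ≤ p) hd) (sub_nonneg.2 hP1)
  have h5 := mul_nonneg hQ (by linarith : 0 ≤ 2 * p - 1)
  unfold drift at *
  rw [pow_succ p (k + 2), pow_succ (1 - p) (k + 2)]
  linear_combination h3 + h4 + h5

/-- Equivalent to `decay (k + 1) p ≤ p` for p > 0: it keeps an increment from overshooting in
`Increases.step`. It fails at `k = 0` for 1/2 < p < 1, so `increases_one` is a separate computation.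
-/
theorem pow_add_mul_pow_le_one (h0 : 0 ≤ p) (h1 : p ≤ 5 / 8) {k : ℕ} (hk : 1 ≤ k) :
    p ^ (k + 2) + (k + 3) * p ^ (k + 1) * (1 - p) ≤ 1 := by
  induction k, hk using Nat.le_induction with
  | base =>
    norm_num
    nlinarith [mul_nonneg (by linarith : 0 ≤ 1 - p) (by nlinarith : 0 ≤ 1 + p - 3 * p ^ 2)]
  | succ k hk ih =>
    have h2 : 0 ≤ p ^ (k + 1) * (1 - p) * (p + ((k + 3) - (k + 4) * p)) :=
      mul_nonneg (mul_nonneg (by positivity) (by linarith))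
        (by nlinarith [(Nat.cast_nonneg k : (0 : ℝ) ≤ k)])
    push_cast
    linear_combination ih + h2

theorem Increases.step (h0 : 1 / 2 ≤ p) (h1 : p ≤ 5 / 8) {k : ℕ} (hk : 1 ≤ k) {x : ℝ}
    (h : Increases p k x) : Increases p (k + 1) (step p k x) := by
  have hp : 0 ≤ p := by linarith
  have hP : 0 ≤ p ^ (k + 1) := by positivity
  have hQ : 0 ≤ (1 - p) ^ (k + 1) := pow_nonneg (by linarith) _
  have hQ2 : 0 ≤ (1 - p) ^ (k + 2) * (2 * p - 1) :=
    mul_nonneg (pow_nonneg (by linarith) _) (by linarith)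
  have hle := h.le_step
  rcases h with ⟨hx, h⟩ | ⟨hx, h⟩
  · rcases le_total 0 (CoinGame.step p k x) with h2 | h2
    · exact increases_of_step_nonneg h0 (by linarith) hx h2
    · refine Or.inl ⟨h2, ?_⟩
      unfold CoinGame.step at *
      rw [max_eq_left hx] at *
      have h3 := mul_nonneg (mul_nonneg (sub_nonneg.2 h) hp)
        (sub_nonneg.2 (pow_add_mul_pow_le_one hp h1 hk))
      have h4 := mul_nonneg (mul_nonneg (mul_nonneg hp hP) (by linarith : 0 ≤ 1 - p))
        (neg_nonneg.2 hx)
      push_cast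
      linear_combination h3 + h4 + hQ2
  · refine Or.inr ⟨hx.trans hle, ?_⟩
    unfold CoinGame.step at *
    rw [max_eq_right hx] at *
    have h3 := mul_nonneg (mul_nonneg (sub_nonneg.2 h) hp)
      (sub_nonneg.2 (pow_le_one₀ hp (by linarith) : p ^ (k + 2) ≤ 1))
    linear_combination h3 + hQ2

theorem increases_one (h0 : 1 / 2 ≤ p) (h1 : p ≤ 5 / 8) : Increases p 1 (step p 0 0) := by
  rcases le_total 0 (step p 0 0) with h2 | h2
  · exact increases_of_step_nonneg h0 (by linarith) le_rfl h2
  · refine Or.inl ⟨h2, ?_⟩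
    have h3 : 0 ≤ (1 - p) * (2 * p - 1) * (1 - p ^ 2) ^ 2 :=
      mul_nonneg (mul_nonneg (by linarith) (by linarith)) (by positivity)
    simp only [step, max_self]
    norm_num
    linear_combination h3

theorem sSeq_two (h0 : 0 ≤ p) (h1 : p ≤ 1) : sSeq 2 p = step p 0 0 := by
  have := sSeq_succ_eq h0 h1 (m := 1) le_rfl (fun j _ _ => by omega)
    (by rw [sSeq_one h0 h1]; linarith)
  rw [sSeq_one h0 h1] at this
  rw [this]
  simp [step]

/-- The claims are proved jointly: monotonicity and the invariant yield the recursion, which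
propagates both. -/
theorem sSeq_increases (h0 : 1 / 2 ≤ p) (h1 : p ≤ 5 / 8) {k : ℕ} (hk : 1 ≤ k) :
    (∀ j, 2 ≤ j → j ≤ k + 1 → sSeq j p ≤ sSeq (k + 1) p) ∧ Increases p k (sSeq (k + 1) p) ∧
      sSeq (k + 2) p = step p k (sSeq (k + 1) p) := by
  have hrec : ∀ k, (∀ j, 2 ≤ j → j ≤ k + 1 → sSeq j p ≤ sSeq (k + 1) p) →
      Increases p k (sSeq (k + 1) p) → sSeq (k + 2) p = step p k (sSeq (k + 1) p) := by
    intro k hm hI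
    rw [sSeq_succ_eq (by linarith) (by linarith) (by omega) hm
      (hI.le_one_sub (by linarith) (by linarith)), step]
    push_cast; ring
  induction k, hk using Nat.le_induction with
  | base =>
    have hI : Increases p 1 (sSeq (1 + 1) p) := by
      rw [sSeq_two (by linarith) (by linarith)]; exact increases_one h0 h1
    have hm : ∀ j, 2 ≤ j → j ≤ 1 + 1 → sSeq j p ≤ sSeq (1 + 1) p := fun j h2 h3 => by
      obtain rfl : j = 2 := by omega
      exact le_rfl
    exact ⟨hm, hI, hrec 1 hm hI⟩
  | succ k hk ih =>
    obtain ⟨hm, hI, hs⟩ := ih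
    have hI' : Increases p (k + 1) (sSeq (k + 1 + 1) p) := by
      rw [hs]; exact hI.step h0 h1 hk
    have hm' : ∀ j, 2 ≤ j → j ≤ k + 1 + 1 → sSeq j p ≤ sSeq (k + 1 + 1) p := fun j h2 h3 => by
      rcases h3.eq_or_lt with rfl | h4
      · exact le_rfl
      · rw [hs]; exact (hm j h2 (by omega)).trans hI.le_step
    exact ⟨hm', hI', hrec (k + 1) hm' hI'⟩

theorem sSeq_add_two (h0 : 1 / 2 ≤ p) (h1 : p ≤ 5 / 8) (k : ℕ) :
    sSeq (k + 2) p = (1 - decay k p) * sSeq (k + 1) p + drift k p +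
      (k + 2) * p ^ (k + 1) * (1 - p) * max 0 (sSeq (k + 1) p) := by
  rw [← step_eq]
  rcases Nat.eq_zero_or_pos k with rfl | hk
  · rw [sSeq_two (by linarith) (by linarith), zero_add, sSeq_one (by linarith) (by linarith)]
  · exact (sSeq_increases h0 h1 hk).2.2

theorem linSeq_le_sSeq (h0 : 1 / 2 ≤ p) (h1 : p ≤ 5 / 8) (k : ℕ) :
    linSeq k p ≤ sSeq (k + 1) p := by
  induction k with
  | zero => rw [zero_add, sSeq_one (by linarith) (by linarith), linSeq]
  | succ k ih =>
    have h2 := decay_lt_one (p := p) (by linarith) (by linarith) k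
    have h3 : 0 ≤ (k + 2) * p ^ (k + 1) * (1 - p) * max 0 (sSeq (k + 1) p) :=
      mul_nonneg (mul_nonneg (by positivity) (by linarith)) (le_max_left _ _)
    rw [linSeq_succ, sSeq_add_two h0 h1]
    nlinarith

theorem sSeq_eq_linSeq (h0 : 1 / 2 ≤ p) (h1 : p ≤ 5 / 8) {k : ℕ}
    (h : ∀ j < k, linSeq j p ≤ 0) : sSeq (k + 1) p = linSeq k p := by
  induction k with
  | zero => rw [zero_add, sSeq_one (by linarith) (by linarith), linSeq]
  | succ k ih =>
    have h2 := ih fun j hj => h j (by omega)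
    rw [linSeq_succ, sSeq_add_two h0 h1, h2, max_eq_left (h k (by omega)), mul_zero, add_zero]

/-- The deviation from the linear recursion after index `N`. -/
theorem sSeq_sub_linSeq_le (h0 : 1 / 2 ≤ p) (h1 : p ≤ 5 / 8) {N : ℕ} {M : ℝ} (hM : 0 ≤ M)
    (hN : ∀ j < N, linSeq j p ≤ 0) (hle : ∀ j, linSeq j p ≤ M) (i : ℕ) :
    sSeq (i + N + 1) p - linSeq (i + N) p ≤
      M * ∑ j ∈ Finset.range i, majorant (j + N) := by
  induction i with
  | zero => simp [sSeq_eq_linSeq h0 h1 hN]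
  | succ i ih =>
    set k := i + N with hk
    have h2 := linSeq_le_sSeq h0 h1 k
    have h3 : 0 ≤ ((k : ℝ) + 2) * p ^ (k + 1) * (1 - p) :=
      mul_nonneg (by positivity) (by linarith)
    have h4 : ((k : ℝ) + 2) * p ^ (k + 1) * (1 - p) ≤ decay k p := by
      have : 0 ≤ p ^ (k + 2) := by positivity
      unfold decay; linarith
    -- The deviation is multiplied by `1 - decay k p` and fed by a coefficient at most `decay k p`
    -- times this maximum; so it grows by at most `M * majorant k`.
    have h5 : max 0 (sSeq (k + 1) p) ≤ M + (sSeq (k + 1) p - linSeq k p) :=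
      max_le (by linarith) (by linarith [hle k])
    have h6 := decay_le_majorant (p := p) (by linarith) (by linarith) k
    rw [Finset.sum_range_succ, show i + 1 + N = k + 1 by omega, linSeq_succ, sSeq_add_two h0 h1]
    have h7 := mul_le_mul_of_nonneg_left h5 h3
    have h8 := mul_le_mul_of_nonneg_right h4 (sub_nonneg.2 h2)
    have h9 := mul_le_mul_of_nonneg_right (h4.trans h6) hM
    linarith

theorem linLim_le_s (h0 : 1 / 2 ≤ p) (h1 : p ≤ 5 / 8) : linLim p ≤ s p :=
  le_of_tendsto_of_tendsto' (tendsto_linSeq (by linarith) (by linarith))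
    ((tendsto_add_atTop_iff_nat 1).2 (tendsto_sSeq (by linarith) (by linarith)))
    (linSeq_le_sSeq h0 h1)

theorem s_eq_linLim (h0 : 1 / 2 ≤ p) (h1 : p ≤ 5 / 8) (h : ∀ j, linSeq j p ≤ 0) :
    s p = linLim p :=
  tendsto_nhds_unique
    ((tendsto_add_atTop_iff_nat 1).2 (tendsto_sSeq (by linarith) (by linarith)))
    ((tendsto_linSeq (by linarith) (by linarith)).congr fun k =>
      (sSeq_eq_linSeq h0 h1 fun j _ => h j).symm)

theorem s_sub_linLim_le (h0 : 1 / 2 ≤ p) (h1 : p ≤ 5 / 8) {N : ℕ} {M : ℝ} (hM : 0 ≤ M)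
    (hN : ∀ j < N, linSeq j p ≤ 0) (hle : ∀ j, linSeq j p ≤ M) :
    s p - linLim p ≤ M * ∑' j, majorant (j + N) := by
  refine le_of_tendsto' (((tendsto_add_atTop_iff_nat (N + 1)).2
    (tendsto_sSeq (by linarith) (by linarith))).sub ((tendsto_add_atTop_iff_nat N).2
      (tendsto_linSeq (p := p) (by linarith) (by linarith)))) fun i =>
    (sSeq_sub_linSeq_le h0 h1 hM hN hle i).trans (mul_le_mul_of_nonneg_left ?_ hM)
  exact ((summable_nat_add_iff N).2 summable_majorant).sum_le_tsum _ fun j _ => majorant_nonneg _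

theorem s_pos_of_five_eighths_le (h0 : 5 / 8 ≤ p) (h1 : p < 1) : 0 < s p := by
  refine pos_of_tendsto_of_one_sub_mul_le (m := 2) (u := fun k => p ^ (k + 1))
    ((summable_nat_add_iff 1).2 (summable_geometric_of_lt_one (by linarith) h1))
    (fun k => by positivity) (fun k => pow_lt_one₀ (by linarith) h1 (by omega)) (fun k hk => ?_) ?_
    (tendsto_sSeq (by linarith) h1.le)
  · have h2 : (1 - p) ^ (k + 1) ≤ p ^ (k + 1) * (1 - p) := by
      obtain ⟨i, rfl⟩ : ∃ i, k = i + 2 := ⟨k - 2, by omega⟩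
      have h3 : (1 - p) ^ i ≤ p ^ i := pow_le_pow_left₀ (by linarith) (by linarith) i
      have h4 : (1 - p) ^ 2 ≤ p ^ 3 := by nlinarith [sq_nonneg p]
      have h5 := mul_le_mul h3 h4 (by positivity) (by positivity)
      have h6 := mul_le_mul_of_nonneg_right h5 (by linarith : 0 ≤ 1 - p)
      linear_combination h6
    linarith [sub_add_le_sSeq_succ (p := p) (by linarith) h1.le k]
  · rw [sSeq_two (by linarith) h1.le]
    -- `sSeq 2 p = (1 - p) * (p ^ 2 + p - 1)` is positive because 5/8 exceeds the root (√5 - 1)/2.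
    simp only [step, max_self]
    have : 0 < (1 - p) * (p ^ 2 + p - 1) := mul_pos (by linarith) (by nlinarith)
    norm_num
    linear_combination this

end Exact

/-! ### Behaviour at and around the critical parameter -/

section Critical

variable {p₀ : ℝ}

theorem eventually_linSeq_nonpos (h : p₀ ∈ Set.Ioo (1 / 2 : ℝ) (5 / 8)) (hz : linLim p₀ = 0)
    (N : ℕ) : ∀ᶠ p in 𝓝 p₀, ∀ j < N, linSeq j p ≤ 0 := by
  refine (eventually_all_finite (Set.finite_lt_nat N)).2 fun j _ => ?_
  rcases Nat.eq_zero_or_pos j with rfl | hj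
  · exact Eventually.of_forall fun p => by simp [linSeq]
  · exact ((hasDerivAt_linSeq j p₀).continuousAt.eventually_lt_const
      (linSeq_neg h.1 (by linarith [h.2]) hz.le hj)).mono fun p hp => hp.le

theorem hasDerivAt_s (h : p₀ ∈ Set.Ioo (1 / 2 : ℝ) (5 / 8)) (hz : linLim p₀ = 0) :
    HasDerivAt s (linLimDeriv p₀) p₀ := by
  have hs0 : s p₀ = linLim p₀ :=
    s_eq_linLim h.1.le h.2.le (linSeq_nonpos h.1 (by linarith [h.2]) hz.le)
  have hsub : HasDerivAt (fun p => s p - linLim p) 0 p₀ := by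
    rw [hasDerivAt_iff_isLittleO, Asymptotics.isLittleO_iff]
    intro δ hδ
    have hlim := (tendsto_sum_nat_add majorant).const_mul derivBound
    rw [mul_zero] at hlim
    -- `N` is fixed before the neighbourhood: the set where the first `N` terms stay nonpositive may
    -- shrink with `N`.
    obtain ⟨N, hN⟩ := (hlim.eventually_lt_const hδ).exists
    filter_upwards [eventually_linSeq_nonpos h hz N, Ioo_mem_nhds h.1 h.2] with p hp hpI
    have h1 := linLim_le_s hpI.1.le hpI.2.le
    have h2 := s_sub_linLim_le hpI.1.le hpI.2.le (M := derivBound * |p - p₀|)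
      (mul_nonneg derivBound_nonneg (abs_nonneg _)) hp fun j => by
        have h3 := abs_linSeq_sub_le (x := p₀) (y := p) ⟨by linarith [h.1], by linarith [h.2]⟩
          ⟨by linarith [hpI.1], by linarith [hpI.2]⟩ j
        have h4 := linSeq_nonpos h.1 (by linarith [h.2]) hz.le j
        linarith [le_abs_self (linSeq j p - linSeq j p₀)]
    rw [hs0, sub_self, sub_zero, smul_zero, sub_zero, Real.norm_eq_abs, Real.norm_eq_abs,
      abs_of_nonneg (by linarith)]
    have := mul_le_mul_of_nonneg_right hN.le (abs_nonneg (p - p₀))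
    linarith
  have := hsub.add (hasDerivAt_linLim (p := p₀) (by linarith [h.1]) (by linarith [h.2]))
  rw [zero_add] at this
  exact this.congr_of_eventuallyEq (Eventually.of_forall fun p => by simp)

theorem hasDerivAt_sSeq (h : p₀ ∈ Set.Ioo (1 / 2 : ℝ) (5 / 8)) (hz : linLim p₀ = 0) (k : ℕ) :
    HasDerivAt (sSeq (k + 1)) (linSeqDeriv k p₀) p₀ := by
  refine (hasDerivAt_linSeq k p₀).congr_of_eventuallyEq ?_
  filter_upwards [eventually_linSeq_nonpos h hz k, Ioo_mem_nhds h.1 h.2] with p hp hpI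
  exact sSeq_eq_linSeq hpI.1.le hpI.2.le hp

theorem differentiableAt_sSeq_zero (h : p₀ ∈ Set.Ioo (0 : ℝ) 1) :
    DifferentiableAt ℝ (sSeq 0) p₀ := by
  refine DifferentiableAt.congr_of_eventuallyEq (f := fun p : ℝ => 1 - p) (by fun_prop) ?_
  filter_upwards [Ioo_mem_nhds h.1 h.2] with p hp
  exact sSeq_zero hp.1.le hp.2.le

theorem s_neg_of_lt (h : p₀ ∈ Set.Ioo (1 / 2 : ℝ) (5 / 8)) (hz : linLim p₀ = 0) {p : ℝ}
    (h0 : 1 / 2 ≤ p) (hp : p < p₀) : s p < 0 := by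
  have hn := linSeq_nonpos h.1 (by linarith [h.2]) hz.le
  rw [s_eq_linLim h0 (by linarith [h.2])
    fun j => (linSeq_le_linSeq (by linarith) hp.le h.2.le hn j).trans (hn j), ← hz]
  exact linLim_lt_linLim (by linarith) hp h.2.le hn

theorem s_pos_of_gt (h : p₀ ∈ Set.Ioo (1 / 2 : ℝ) (5 / 8)) (hz : linLim p₀ = 0) {p : ℝ}
    (hp : p₀ < p) (h1 : p < 1) : 0 < s p := by
  rcases le_total (5 / 8) p with h2 | h2
  · exact s_pos_of_five_eighths_le h2 h1
  refine lt_of_lt_of_le ?_ (linLim_le_s (by linarith [h.1]) h2)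
  -- If `linLim p ≤ 0`, strict monotonicity up to `p` would give `linLim p₀ < 0`.
  by_contra! h3
  have := linLim_lt_linLim (by linarith [h.1]) hp h2
    (linSeq_nonpos (by linarith [h.1]) (by linarith) h3)
  linarith

end Critical

end CoinGame

theorem mainTheorem5 :
    -- the limit defining `s p` exists
    (∀ p ∈ Set.Icc (1 / 2 : ℝ) 1,
      Tendsto (fun n : ℕ => CoinGame.sSeq n p) atTop (𝓝 (CoinGame.s p))) ∧
    ∃ p₀ ∈ Set.Ioo (1 / 2 : ℝ) 1,
      -- these three conditions determine the constant `p₀`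
      CoinGame.s p₀ = 0 ∧
      (∀ p : ℝ, 1 / 2 ≤ p → p < p₀ → CoinGame.s p < 0) ∧
      (∀ p : ℝ, p₀ < p → p < 1 → 0 < CoinGame.s p) ∧
      -- differentiability at `p₀`
      DifferentiableAt ℝ CoinGame.s p₀ ∧
      0 < deriv CoinGame.s p₀ ∧
      (∀ n : ℕ, DifferentiableAt ℝ (CoinGame.sSeq n) p₀) ∧
      Tendsto (fun n : ℕ => deriv (CoinGame.sSeq n) p₀) atTop (𝓝 (deriv CoinGame.s p₀)) := by
  obtain ⟨p₀, h, hz⟩ := CoinGame.exists_linLim_eq_zero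
  have h0 : 1 / 2 < p₀ := h.1
  have h1 : p₀ < 5 / 8 := h.2
  have hs := CoinGame.hasDerivAt_s h hz
  refine ⟨fun p hp => CoinGame.tendsto_sSeq (by linarith [hp.1]) hp.2, p₀,
    ⟨h0, by linarith⟩, ?_, fun p => CoinGame.s_neg_of_lt h hz,
    fun p => CoinGame.s_pos_of_gt h hz, hs.differentiableAt, ?_, fun n => ?_, ?_⟩
  · rw [← hz]
    exact CoinGame.s_eq_linLim h0.le h1.le (CoinGame.linSeq_nonpos h0 (by linarith) hz.le)
  · rw [hs.deriv]
    exact CoinGame.linLimDeriv_pos h0 h1.le hz.le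
  · rcases n with _ | k
    · exact CoinGame.differentiableAt_sSeq_zero ⟨by linarith, by linarith⟩
    · exact (CoinGame.hasDerivAt_sSeq h hz k).differentiableAt
  · rw [hs.deriv, ← tendsto_add_atTop_iff_nat 1]
    simp_rw [fun k => (CoinGame.hasDerivAt_sSeq h hz k).deriv]
    exact CoinGame.tendsto_linSeqDeriv (by linarith) (by linarith)
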